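/- Let $P, P_1, P_2, W_2 \in \mathbb{C}[z]$ be polynomials with $P$ non-constant, and let $n \ge 1$ be an integer such that $$P = P_1 \circ z^n = P_2 \circ W_2.$$ Put $e = \gcd(n, \deg W_2)$. Then there exist polynomials $R, U \in \mathbb{C}[z]$, a polynomial $\sigma \in \mathbb{C}[z]$ of degree one and an integer $s \ge 0$ such that $$W_2(z) = \sigma\bigl(z^s R(z^n)\bigr) \quad\text{and}\quad P(z) = U\bigl(z^{sn/e}\, R(z^n)^{n/e}\bigr).$$ -/

import Mathlib

open Polynomial

/-!
Let `ε` be a primitive `n`-th root of unity. Since `P` is a polynomial in `z ^ n`, the polynomials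
`W₂(ε z)` and `W₂(z)` have the same composition with `P₂`. Two polynomials of the same positive
degree with this property differ by an affine map (`exists_eq_affine_of_comp_eq_comp`), so
`W₂(ε z) = a W₂(z) + b`. Comparing coefficients, all exponents occurring in `T = W₂ - W₂(0)` are
congruent to `deg W₂` modulo `n`, which says that `T = z ^ s R(z ^ n)` and that
`T(ε z) = ε ^ deg W₂ T(z)`.

Write `P = Q ∘ T`. Invariance of `P` under `z ↦ ε z` gives
`Q(ε ^ deg W₂ T) = Q(T)`, and cancelling the non-constant `T` on the right shows that `Q` is
invariant under multiplication of the variable by `ε ^ deg W₂`, a root of unity of exact order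
`n / e`. Hence `Q` is a polynomial in `z ^ (n / e)`.
-/

/-- A polynomial whose exponents are all congruent to `s` modulo `n` is `X ^ s` times a polynomial
in `X ^ n`, provided `s` is the least nonnegative residue. -/
theorem exists_eq_X_pow_mul_comp_X_pow {K : Type*} [CommRing K] {n s : ℕ} (hs : s < n) (f : K[X])
    (hf : ∀ k, f.coeff k ≠ 0 → k ≡ s [MOD n]) :
    ∃ R : K[X], f = X ^ s * R.comp (X ^ n) := by
  have hn : 0 < n := by omega
  obtain ⟨h, rfl⟩ : X ^ s ∣ f := by
    rw [X_pow_dvd_iff]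
    intro d hd
    by_contra hne
    have := hf d hne
    rw [Nat.ModEq, Nat.mod_eq_of_lt hs, Nat.mod_eq_of_lt (hd.trans hs)] at this
    omega
  refine ⟨contract n h, ?_⟩
  congr 1
  rw [← expand_eq_comp_X_pow]
  ext k
  rw [coeff_expand hn, coeff_contract hn.ne']
  split_ifs with hk
  · rw [Nat.div_mul_cancel hk]
  · by_contra hne
    refine hk ((Nat.modEq_zero_iff_dvd).1 ?_)
    refine Nat.ModEq.add_right_cancel' s ?_
    rw [zero_add]
    exact hf (k + s) (by rwa [coeff_X_pow_mul])

/-- A homogeneous form `∑ V ^ i * W ^ (d - 1 - i)` in two polynomials of the same degree and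
leading coefficient has no cancellation at the top in characteristic zero. -/
theorem le_natDegree_geom_sum₂ {K : Type*} [Field K] [CharZero K] {V W : K[X]}
    (hdeg : V.natDegree = W.natDegree) (hlc : V.leadingCoeff = W.leadingCoeff) (hW : W ≠ 0)
    {d : ℕ} (hd : 0 < d) :
    (d - 1) * W.natDegree ≤
      (∑ i ∈ Finset.range d, V ^ i * W ^ (d - 1 - i)).natDegree := by
  apply le_natDegree_of_ne_zero
  have hterm : ∀ i ∈ Finset.range d,
      (V ^ i * W ^ (d - 1 - i)).coeff ((d - 1) * W.natDegree) = W.leadingCoeff ^ (d - 1) := by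
    intro i hi
    have hi' : i + (d - 1 - i) = d - 1 := by
      have := Finset.mem_range.1 hi
      omega
    have hV : V ≠ 0 := by
      rw [← leadingCoeff_ne_zero, hlc]
      exact leadingCoeff_ne_zero.2 hW
    have hnd : (V ^ i * W ^ (d - 1 - i)).natDegree = (d - 1) * W.natDegree := by
      rw [natDegree_mul (pow_ne_zero _ hV) (pow_ne_zero _ hW), natDegree_pow, natDegree_pow, hdeg,
        ← add_mul, hi']
    rw [← hnd, coeff_natDegree, leadingCoeff_mul, leadingCoeff_pow, leadingCoeff_pow, hlc,
      ← pow_add, hi']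
  rw [finsetSum_coeff, Finset.sum_congr rfl hterm, Finset.sum_const, Finset.card_range,
    nsmul_eq_mul]
  exact mul_ne_zero (by exact_mod_cast hd.ne') (pow_ne_zero _ (leadingCoeff_ne_zero.2 hW))

/-- If `f ∘ V = f ∘ W` with `f` non-constant and `V`, `W` of the same positive degree, then `V` is
an affine function of `W`. With `d = deg f` and `a` the ratio of the leading coefficients,
`V ^ d - (a W) ^ d = V ^ d - W ^ d` has degree at most `(d - 1) deg W` because the lower terms of
`f` contribute no more, whereas its factor other than `V - a W` already has this degree. -/
theorem exists_eq_affine_of_comp_eq_comp {K : Type*} [Field K] [CharZero K] {f V W : K[X]}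
    (hf : 0 < f.natDegree) (hdeg : V.natDegree = W.natDegree) (hW : 0 < W.natDegree)
    (h : f.comp V = f.comp W) :
    ∃ a b : K, V = C a * W + C b := by
  have hV : 0 < V.natDegree := hdeg ▸ hW
  have hW0 : W ≠ 0 := ne_zero_of_natDegree_gt hW
  have hf0 : f ≠ 0 := ne_zero_of_natDegree_gt hf
  have hlW : W.leadingCoeff ≠ 0 := leadingCoeff_ne_zero.2 hW0
  have hlV : V.leadingCoeff ≠ 0 := leadingCoeff_ne_zero.2 (ne_zero_of_natDegree_gt hV)
  have hlf : f.leadingCoeff ≠ 0 := leadingCoeff_ne_zero.2 hf0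
  set d := f.natDegree with hd
  set a := V.leadingCoeff / W.leadingCoeff with ha
  have ha0 : a ≠ 0 := div_ne_zero hlV hlW
  have had : a ^ d = 1 := by
    have := congrArg leadingCoeff h
    rw [leadingCoeff_comp hV.ne', leadingCoeff_comp hW.ne'] at this
    rw [ha, div_pow, mul_left_cancel₀ hlf this, div_self (pow_ne_zero _ hlW)]
  have hdeg' : V.natDegree = (C a * W).natDegree := by rw [natDegree_C_mul ha0, hdeg]
  have hlc' : V.leadingCoeff = (C a * W).leadingCoeff := by
    rw [leadingCoeff_mul, leadingCoeff_C, ha, div_mul_cancel₀ _ hlW]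
  have hsum := le_natDegree_geom_sum₂ hdeg' hlc' (mul_ne_zero (C_ne_zero.2 ha0) hW0) hf
  have hfac := geom_sum₂_mul V (C a * W) d
  rw [mul_pow (C a), ← C_pow, had, C_1, one_mul] at hfac
  have hsplit : ∀ T : K[X], f.comp T = f.eraseLead.comp T + C f.leadingCoeff * T ^ d := by
    intro T
    have := congrArg (fun p => comp p T) (eraseLead_add_C_mul_X_pow f).symm
    simpa only [add_comp, C_mul_comp, X_pow_comp, ← hd] using this
  have hlow : (C f.leadingCoeff * (V ^ d - W ^ d)).natDegree ≤ (d - 1) * W.natDegree := by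
    have : C f.leadingCoeff * (V ^ d - W ^ d) = f.eraseLead.comp W - f.eraseLead.comp V := by
      rw [hsplit, hsplit] at h
      linear_combination h
    rw [this]
    refine (natDegree_sub_le _ _).trans (max_le ?_ ?_)
    · exact natDegree_comp_le.trans (Nat.mul_le_mul_right _ (eraseLead_natDegree_le f))
    · exact natDegree_comp_le.trans
        (hdeg ▸ Nat.mul_le_mul_right _ (eraseLead_natDegree_le f))
  rw [natDegree_C_mul hlf, ← hfac] at hlow
  have hQ : (V - C a * W).natDegree = 0 := by
    by_cases hQ0 : V - C a * W = 0
    · rw [hQ0, natDegree_zero]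
    by_cases hS0 : ∑ i ∈ Finset.range d, V ^ i * (C a * W) ^ (d - 1 - i) = 0
    -- The sum can only vanish if its lower degree bound is trivial; then `d = 1` and it equals `1`.
    · rw [hS0, natDegree_zero, natDegree_C_mul ha0] at hsum
      have hd1 : d = 1 := by
        rcases Nat.mul_eq_zero.1 (Nat.le_zero.1 hsum) with h1 | h1 <;> omega
      rw [hd1] at hS0
      simp at hS0
    rw [natDegree_mul hS0 hQ0] at hlow
    rw [natDegree_C_mul ha0] at hsum
    omega
  obtain ⟨b, hb⟩ := natDegree_eq_zero.1 hQ
  exact ⟨a, b, by rw [hb]; ring⟩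

theorem lemma3p1 (n : ℕ) (P P₁ P₂ W₂ : ℂ[X]) (hP : 0 < P.natDegree)
    (h₁ : P = P₁.comp (X ^ n)) (h₂ : P = P₂.comp W₂) :
    ∃ (R U σ : ℂ[X]) (s : ℕ), σ.natDegree = 1 ∧
      W₂ = σ.comp (X ^ s * R.comp (X ^ n)) ∧
      P = U.comp (X ^ (s * n / n.gcd W₂.natDegree) *
        (R ^ (n / n.gcd W₂.natDegree)).comp (X ^ n)) := by
  -- For `n = 0` the composition with `X ^ n` would be constant.
  have hn : 0 < n := by
    rcases Nat.eq_zero_or_pos n with rfl | hn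
    · rw [h₁, natDegree_comp] at hP
      simp at hP
    · exact hn
  have hdegs : 0 < P₂.natDegree * W₂.natDegree := by rwa [← natDegree_comp, ← h₂]
  have hm : 0 < W₂.natDegree := Nat.pos_of_mul_pos_left hdegs
  have hd : 0 < P₂.natDegree := Nat.pos_of_mul_pos_right hdegs
  set m := W₂.natDegree
  obtain ⟨ε, hε⟩ : ∃ ε : ℂ, IsPrimitiveRoot ε n := ⟨_, Complex.isPrimitiveRoot_exp n hn.ne'⟩
  have hε0 : ε ≠ 0 := hε.ne_zero hn.ne'
  have hpow_iff : ∀ k, ε ^ k = ε ^ m ↔ k ≡ m [MOD n] := by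
    intro k
    rw [(hε.isOfFinOrder hn.ne').pow_eq_pow_iff_modEq, ← hε.eq_orderOf]
  have hPε : P.comp (C ε * X) = P := by
    rw [h₁, comp_assoc]
    simp [mul_pow, ← C_pow, hε.pow_eq_one]
  have hdegε : (W₂.comp (C ε * X)).natDegree = m := by
    rw [natDegree_comp, natDegree_C_mul_X _ hε0, mul_one]
  obtain ⟨a, b, hab⟩ := exists_eq_affine_of_comp_eq_comp (V := W₂.comp (C ε * X)) hd hdegε hm
    (by rw [← comp_assoc, ← h₂, hPε])
  have hcoeff : ∀ k, 0 < k → W₂.coeff k * ε ^ k = a * W₂.coeff k := by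
    intro k hk
    have := congrArg (fun p => coeff p k) hab
    simpa [comp_C_mul_X_coeff, coeff_C, hk.ne'] using this
  have ha : a = ε ^ m := by
    have hlc : W₂.coeff m ≠ 0 := leadingCoeff_ne_zero.2 (ne_zero_of_natDegree_gt hm)
    refine mul_right_cancel₀ hlc ?_
    rw [← hcoeff m hm, mul_comm]
  obtain ⟨T, hT⟩ : ∃ T, T = W₂ - C (W₂.coeff 0) := ⟨_, rfl⟩
  have hTexp : ∀ k, T.coeff k ≠ 0 → k ≡ m [MOD n] := by
    intro k hk
    have hk0 : 0 < k := by
      rcases Nat.eq_zero_or_pos k with rfl | hk0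
      · simp [hT] at hk
      · exact hk0
    have hWk : W₂.coeff k ≠ 0 := by simpa [hT, coeff_C, hk0.ne'] using hk
    have heq : ε ^ k = ε ^ m := by
      refine mul_left_cancel₀ hWk ?_
      rw [hcoeff k hk0, ha, mul_comm]
    exact (hpow_iff k).1 heq
  obtain ⟨R, hR⟩ := exists_eq_X_pow_mul_comp_X_pow (Nat.mod_lt m hn) T
    (fun k hk => (hTexp k hk).trans (Nat.mod_modEq m n).symm)
  have hWT : W₂ = (X + C (W₂.coeff 0)).comp T := by simp [hT]
  obtain ⟨Q, hQ⟩ : ∃ Q, Q = P₂.comp (X + C (W₂.coeff 0)) := ⟨_, rfl⟩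
  have hPQ : P = Q.comp T := by rw [hQ, comp_assoc, ← hWT, h₂]
  have hTε : T.comp (C ε * X) = C (ε ^ m) * T := by
    ext k
    rw [comp_C_mul_X_coeff, coeff_C_mul]
    by_cases hk : T.coeff k = 0
    · simp [hk]
    · rw [(hpow_iff k).2 (hTexp k hk), mul_comm]
  have hTdeg : 0 < T.natDegree := by rwa [hT, natDegree_sub_C]
  have hQε : Q.comp (C (ε ^ m) * X) = Q := by
    have hcomp : (Q.comp (C (ε ^ m) * X) - Q).comp T = 0 := by
      rw [sub_comp, comp_assoc, ← hPQ]
      conv_lhs => rw [← hPε]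
      rw [hPQ, comp_assoc, hTε]
      simp
    rcases comp_eq_zero_iff.1 hcomp with h0 | ⟨-, hc⟩
    · exact sub_eq_zero.1 h0
    · rw [hc, natDegree_C] at hTdeg
      exact absurd hTdeg (lt_irrefl 0)
  have he : n.gcd m ∣ n := Nat.gcd_dvd_left n m
  have horder : orderOf (ε ^ m) = n / n.gcd m := by
    rw [orderOf_pow' ε hm.ne', ← hε.eq_orderOf]
  have hqpos : 0 < n / n.gcd m := Nat.div_pos (Nat.le_of_dvd hn he) (Nat.gcd_pos_of_pos_left m hn)
  obtain ⟨U, hU⟩ := exists_eq_X_pow_mul_comp_X_pow hqpos Q (by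
    intro k hk
    rw [Nat.modEq_zero_iff_dvd, ← horder]
    apply orderOf_dvd_of_pow_eq_one
    have := congrArg (fun p => coeff p k) hQε
    simp only [comp_C_mul_X_coeff] at this
    exact mul_left_cancel₀ hk (by rw [this, mul_one]))
  rw [pow_zero, one_mul] at hU
  refine ⟨R, U, X + C (W₂.coeff 0), m % n, natDegree_X_add_C _, ?_, ?_⟩
  · rw [← hR]
    exact hWT
  · have hpow : X ^ (m % n * n / n.gcd m) * (R ^ (n / n.gcd m)).comp (X ^ n)
        = T ^ (n / n.gcd m) := by
      rw [Nat.mul_div_assoc _ he, pow_mul, pow_comp, ← mul_pow, ← hR]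
    rw [hpow, hPQ, hU, comp_assoc, X_pow_comp]
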